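/- Let $G$ be a finite simple graph on $n\geqslant 1$ vertices, and let $\lambda_1\geqslant\lambda_2\geqslant\cdots\geqslant\lambda_n$ be the eigenvalues of its adjacency matrix, listed with multiplicity. The HL-index of $G$ is $$R(G)=\max\left\{\left|\lambda_{\lfloor (n+1)/2\rfloor}\right|,\ \left|\lambda_{\lceil (n+1)/2\rceil}\right|\right\}.$$ If $G$ is connected, bipartite and not regular, and its maximum degree $\Delta$ satisfies $\Delta\geqslant 3$, then $$R(G)\leqslant\sqrt{\Delta-2}.$$ -/

import Mathlib

/-- The `k`-th largest eigenvalue `λ_k` (counted from `1`, with multiplicity) of the real adjacency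
matrix of `G`; Mathlib's `eigenvalues₀` is the non-increasing list of eigenvalues, counted from
`0`. -/
noncomputable def SimpleGraph.nthEigenvalue {V : Type*} [Fintype V] [DecidableEq V]
    (G : SimpleGraph V) [DecidableRel G.Adj] (k : ℕ) (hk : 1 ≤ k ∧ k ≤ Fintype.card V) : ℝ :=
  (G.isHermitian_adjMatrix ℝ).eigenvalues₀ ⟨k - 1, by omega⟩

/-- The HL-index `R(G) = max {|λ_⌊(n+1)/2⌋|, |λ_⌈(n+1)/2⌉|}` of a graph with `n ≥ 1` vertices. The
divisions below are natural-number divisions, with `⌈(n+1)/2⌉ = ⌊(n+2)/2⌋`. -/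
noncomputable def SimpleGraph.hlIndex {V : Type*} [Fintype V] [DecidableEq V] [Nonempty V]
    (G : SimpleGraph V) [DecidableRel G.Adj] : ℝ :=
  max
    |G.nthEigenvalue ((Fintype.card V + 1) / 2)
      (by have := Fintype.card_pos (α := V); omega)|
    |G.nthEigenvalue ((Fintype.card V + 2) / 2)
      (by have := Fintype.card_pos (α := V); omega)|

namespace Matrix.IsHermitian

variable {n : Type*} [Fintype n] [DecidableEq n] {A : Matrix n n ℝ}

lemma roots_charpoly_neg_eq_eigenvalues₀ (hA : A.IsHermitian) :
    (-A).charpoly.roots = Multiset.map (-hA.eigenvalues₀) Finset.univ.val := by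
  have hchar : (-A).charpoly = ∏ i, (Polynomial.X - Polynomial.C (-hA.eigenvalues i)) := by
    conv_lhs => rw [hA.spectral_theorem, ← map_neg, Unitary.conjStarAlgAut_apply,
      charpoly_mul_comm, ← mul_assoc]
    simp only [Matrix.diagonal_neg, Unitary.coe_star_mul_self, one_mul, charpoly_diagonal]
    simp
  rw [hchar, Polynomial.roots_prod]
  · simp only [Polynomial.roots_X_sub_C, Multiset.bind_singleton]
    have hcomp : (fun i => -hA.eigenvalues i) =
        (-hA.eigenvalues₀) ∘ (Fintype.equivOfCardEq (Fintype.card_fin _)).symm := rfl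
    rw [hcomp, ← Multiset.map_map, Multiset.map_univ_val_equiv]
  · exact Finset.prod_ne_zero_iff.2 fun i _ => Polynomial.X_sub_C_ne_zero _

/-- If `A` and `-A` have the same characteristic polynomial, then the spectrum of `A` is symmetric
about zero. -/
lemma eigenvalues₀_rev (hA : A.IsHermitian) (h : (-A).charpoly = A.charpoly)
    (k : Fin (Fintype.card n)) : hA.eigenvalues₀ k.rev = -hA.eigenvalues₀ k := by
  have hroots := hA.roots_charpoly_neg_eq_eigenvalues₀
  rw [h, hA.roots_charpoly_eq_eigenvalues₀] at hroots
  have hrev : Multiset.map (-hA.eigenvalues₀) Finset.univ.val =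
      Multiset.map (fun i : Fin (Fintype.card n) => -hA.eigenvalues₀ i.rev) Finset.univ.val := by
    conv_lhs => rw [← Multiset.map_univ_val_equiv Fin.revPerm, Multiset.map_map]
    rfl
  rw [hrev, Fin.univ_val_map, Fin.univ_val_map, Multiset.coe_eq_coe] at hroots
  have hanti : Antitone fun k : Fin (Fintype.card n) => -hA.eigenvalues₀ k.rev := fun i j hij =>
    neg_le_neg (hA.eigenvalues₀_antitone (Fin.rev_le_rev.2 hij))
  have heq := List.ofFn_injective <| hroots.eq_of_pairwise'
    (r := (· ≥ ·)) hA.eigenvalues₀_antitone.sortedGE_ofFn.pairwise hanti.sortedGE_ofFn.pairwise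
  have hk : hA.eigenvalues₀ k = -hA.eigenvalues₀ k.rev := congrFun heq k
  linarith

lemma posDef_mul_self_sub (hA : A.IsHermitian) {d : ℝ} (hd : ∀ i, d < hA.eigenvalues i ^ 2) :
    (A * A - d • 1).PosDef := by
  have heq : A * A - d • 1 = Unitary.conjStarAlgAut ℝ _ hA.eigenvectorUnitary
      (diagonal fun i => hA.eigenvalues i ^ 2 - d) := by
    have hdiag : (diagonal fun i => hA.eigenvalues i ^ 2 - d) =
        diagonal hA.eigenvalues * diagonal hA.eigenvalues - d • 1 := by
      rw [diagonal_mul_diagonal, smul_one_eq_diagonal, diagonal_sub]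
      simp [sq]
    have hs := hA.spectral_theorem
    simp only [RCLike.ofReal_real_eq_id, Function.id_comp] at hs
    rw [hdiag, map_sub, map_mul, map_smul, map_one, ← hs]
  rw [heq, Unitary.conjStarAlgAut_apply]
  refine (Matrix.IsUnit.posDef_star_right_conjugate_iff
    (Unitary.isUnit_coe (U := hA.eigenvectorUnitary))).2 ?_
  exact Matrix.PosDef.diagonal fun i => sub_pos.2 (hd i)

end Matrix.IsHermitian

lemma Antitone.lt_abs_of_rev {n : ℕ} {f : Fin n → ℝ} (hf : Antitone f)
    (hrev : ∀ k, f k.rev = -f k) {i j : Fin n} (hij : j.val ≤ i.val + 1) (hji : i.rev = j)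
    (hle : i ≤ j) {c : ℝ} (hc : c < |f i|) (k : Fin n) : c < |f k| := by
  have hj : f j = -f i := hji ▸ hrev i
  have hi : 0 ≤ f i := by linarith [hf hle]
  rw [abs_of_nonneg hi] at hc
  rcases le_or_gt k i with hk | hk
  · exact (hc.trans_le (hf hk)).trans_le (le_abs_self _)
  · have := hf (show j ≤ k by rw [Fin.le_def]; rw [Fin.lt_def] at hk; omega)
    exact lt_of_lt_of_le (by linarith) (neg_le_abs (f k))

namespace SimpleGraph

variable {V : Type*} [Fintype V] [DecidableEq V] {G : SimpleGraph V} [DecidableRel G.Adj]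

lemma IsBipartite.charpoly_neg_adjMatrix (h : G.IsBipartite) :
    (-G.adjMatrix ℝ).charpoly = (G.adjMatrix ℝ).charpoly := by
  obtain ⟨C⟩ := h
  let S : Matrix V V ℝ := Matrix.diagonal fun v => if C v = 0 then 1 else -1
  have hS : S * S = 1 := by
    rw [Matrix.diagonal_mul_diagonal, ← Matrix.diagonal_one]
    congr 1
    ext v
    split_ifs <;> simp
  have hneg : -G.adjMatrix ℝ = S * G.adjMatrix ℝ * S := by
    ext u v
    rw [Matrix.mul_diagonal, Matrix.diagonal_mul]
    by_cases huv : G.Adj u v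
    · have := C.valid huv
      have : (C u = 0 ↔ ¬ C v = 0) := by omega
      by_cases hv : C v = 0 <;> simp [huv, hv, this]
    · simp [huv]
  rw [hneg, mul_assoc, Matrix.charpoly_mul_comm, mul_assoc, hS, mul_one]


variable (G) in
/-- The quadratic form `z ↦ ‖Az‖² - d‖z‖²` of the adjacency matrix `A` is positive definite. -/
def SqAdjExceeds (d : ℝ) : Prop :=
  ∀ z : V → ℝ, z ≠ 0 → 0 < z ⬝ᵥ (G.adjMatrix ℝ * G.adjMatrix ℝ - d • 1).mulVec z

variable (G) in
/-- The number of common neighbours of two vertices. -/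
def codegree (u v : V) : ℕ := (G.neighborFinset u ∩ G.neighborFinset v).card

variable (G) in
/-- The matrix of codegrees. -/
def codegreeMatrix : Matrix V V ℝ := Matrix.of fun u v => (G.codegree u v : ℝ)

@[simp]
lemma codegreeMatrix_apply (u v : V) : G.codegreeMatrix u v = G.codegree u v := rfl

lemma adjMatrix_mul_self : G.adjMatrix ℝ * G.adjMatrix ℝ = G.codegreeMatrix := by
  ext u v
  rw [adjMatrix_mul_apply]
  simp only [adjMatrix_apply, Finset.sum_boole, codegreeMatrix_apply, codegree]
  congr 2
  ext w
  simp [G.adj_comm]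

lemma codegree_self (u : V) : G.codegree u u = G.degree u := by
  simp [codegree]

lemma codegree_comm (u v : V) : G.codegree u v = G.codegree v u := by
  simp [codegree, Finset.inter_comm]

lemma one_le_codegree {u v w : V} (hu : G.Adj u w) (hv : G.Adj v w) : 1 ≤ G.codegree u v :=
  Finset.card_pos.2 ⟨w, by simp [hu, hv]⟩

lemma exists_adj_of_codegree {u v : V} (h : 1 ≤ G.codegree u v) : ∃ w, G.Adj u w ∧ G.Adj v w := by
  obtain ⟨w, hw⟩ := Finset.card_pos.1 h
  exact ⟨w, by simpa using hw⟩

namespace SqAdjExceeds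

variable {D : ℕ}

lemma degree_gt (h : G.SqAdjExceeds D) (u : V) : D < G.degree u := by
  have := h (Pi.single u 1) (by simp)
  rw [adjMatrix_mul_self] at this
  simp [codegree_self] at this
  exact_mod_cast this

lemma two_mul_codegree_lt (h : G.SqAdjExceeds D) {u v : V} (huv : u ≠ v) :
    2 * G.codegree u v + 2 * D < G.degree u + G.degree v := by
  have := h (Pi.single u 1 - Pi.single v 1) (fun h0 => by simpa [huv] using congrFun h0 u)
  rw [adjMatrix_mul_self] at this
  simp [codegree_self, Matrix.mulVec_sub, sub_dotProduct, huv, huv.symm,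
    codegree_comm v u] at this
  have h2 : ((2 * G.codegree u v + 2 * D : ℕ) : ℝ) < (G.degree u + G.degree v : ℕ) := by
    push_cast
    linarith
  exact_mod_cast h2

lemma three_mul_lt (h : G.SqAdjExceeds D) {e f p : V} (hef : e ≠ f) (hep : e ≠ p) (hfp : f ≠ p) :
    6 * D + 4 * G.codegree e f + 4 * G.codegree e p <
      G.degree f + G.degree p + 4 * G.degree e + 2 * G.codegree f p := by
  have := h (Pi.single f 1 + Pi.single p 1 - Pi.single e 2)
    (fun h0 => by simpa [hef, hfp, hef.symm] using congrFun h0 f)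
  rw [adjMatrix_mul_self] at this
  simp [codegree_self, Matrix.mulVec_sub, Matrix.mulVec_add, add_dotProduct,
    sub_dotProduct, hef, hep, hfp, hef.symm, hep.symm, hfp.symm,
    codegree_comm f e, codegree_comm p e, codegree_comm p f] at this
  have h2 : ((6 * D + 4 * G.codegree e f + 4 * G.codegree e p : ℕ) : ℝ) <
      (G.degree f + G.degree p + 4 * G.degree e + 2 * G.codegree f p : ℕ) := by
    push_cast
    linarith
  exact_mod_cast h2

lemma four_mul_lt (h : G.SqAdjExceeds D) {e f p x : V} (hef : e ≠ f) (hep : e ≠ p) (hfp : f ≠ p)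
    (hxe : x ≠ e) (hxf : x ≠ f) (hxp : x ≠ p) :
    7 * D + 4 * G.codegree e f + 4 * G.codegree e p + 2 * G.codegree x f + 2 * G.codegree x p <
      G.degree x + G.degree f + G.degree p + 4 * G.degree e + 2 * G.codegree f p
        + 4 * G.codegree x e := by
  have := h (Pi.single x 1 - Pi.single f 1 - Pi.single p 1 + Pi.single e 2)
    (fun h0 => by simpa [hxe, hxf, hxp] using congrFun h0 x)
  rw [adjMatrix_mul_self] at this
  simp [codegree_self, Matrix.mulVec_sub, Matrix.mulVec_add, add_dotProduct,
    sub_dotProduct, hef, hep, hfp, hef.symm, hep.symm, hfp.symm, hxe, hxf, hxp, hxe.symm,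
    hxf.symm, hxp.symm, codegree_comm f e, codegree_comm p e, codegree_comm p f,
    codegree_comm f x, codegree_comm p x, codegree_comm e x] at this
  have h2 : ((7 * D + 4 * G.codegree e f + 4 * G.codegree e p + 2 * G.codegree x f
      + 2 * G.codegree x p : ℕ) : ℝ) < (G.degree x + G.degree f + G.degree p + 4 * G.degree e
      + 2 * G.codegree f p + 4 * G.codegree x e : ℕ) := by
    push_cast
    linarith
  exact_mod_cast h2

lemma codegree_le_one (h : G.SqAdjExceeds D) (hmax : ∀ v, G.degree v ≤ D + 2) {u v : V}
    (huv : u ≠ v) : G.codegree u v ≤ 1 := by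
  have := h.two_mul_codegree_lt huv
  have := hmax u
  have := hmax v
  omega

lemma eq_of_adj (h : G.SqAdjExceeds D) (hmax : ∀ v, G.degree v ≤ D + 2) {u v a b : V}
    (huv : u ≠ v) (hua : G.Adj u a) (hva : G.Adj v a) (hub : G.Adj u b) (hvb : G.Adj v b) :
    a = b :=
  Finset.card_le_one.1 (h.codegree_le_one hmax huv) a (by simp [hua, hva]) b (by simp [hub, hvb])

/-- Of two vertices with a common neighbour, at most one has degree `D + 1`. -/
lemma degree_eq_of_adj (h : G.SqAdjExceeds D) (hmax : ∀ v, G.degree v ≤ D + 2) {u v w : V}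
    (huv : u ≠ v) (hu : G.Adj u w) (hv : G.Adj v w) (hdeg : G.degree u ≤ D + 1) :
    G.degree v = D + 2 := by
  have := h.two_mul_codegree_lt huv
  have := one_le_codegree hu hv
  have := hmax v
  omega

/-- A vertex `l` of degree `D + 2` not adjacent to `e` has a neighbour at distance more than two
from `e`, when `e` has degree at most `D + 1`. -/
lemma exists_adj_codegree_eq_zero (h : G.SqAdjExceeds D) (hmax : ∀ v, G.degree v ≤ D + 2)
    {e l : V} (he : G.degree e ≤ D + 1) (hl : G.degree l = D + 2) (hel : ¬ G.Adj e l) :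
    ∃ x, G.Adj l x ∧ G.codegree x e = 0 := by
  by_contra! hcon
  have hw : ∀ y ∈ G.neighborFinset l, ∃ w, G.Adj y w ∧ G.Adj e w := fun y hy =>
    exists_adj_of_codegree (Nat.one_le_iff_ne_zero.2 (hcon y (by simpa using hy)))
  choose! w hyw hew using hw
  have hcard : (G.neighborFinset l).card ≤ (G.neighborFinset e).card := by
    refine Finset.card_le_card_of_injOn w (fun y hy => by simpa using hew y hy) ?_
    intro y hy y' hy' hyy
    have hly : G.Adj l y := by simpa using hy
    have hly' : G.Adj l y' := by simpa using hy'
    have hne : l ≠ w y := fun hlw => hel (hlw ▸ hew y hy)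
    exact h.eq_of_adj hmax hne hly (hyw y hy).symm hly' (hyy ▸ (hyw y' hy').symm)
  simp only [card_neighborFinset_eq_degree] at hcard
  omega

/-- If `e` has degree at most `D + 1` and `a`, `b` are two of its neighbours, then any further
neighbour `l` of a vertex `f ~ a` has a common neighbour with `b`, provided `b` has degree
`D + 2`. -/
lemma exists_common_adj (h : G.SqAdjExceeds D) (hmax : ∀ v, G.degree v ≤ D + 2)
    {e a b f l : V} (he : G.degree e ≤ D + 1) (hab : a ≠ b) (hea : G.Adj e a) (heb : G.Adj e b)
    (hb : G.degree b = D + 2) (hfe : f ≠ e) (hfa : G.Adj f a) (hfl : G.Adj f l) (hla : l ≠ a) :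
    ∃ p, p ≠ e ∧ G.Adj b p ∧ G.Adj l p := by
  have hf : G.degree f = D + 2 := h.degree_eq_of_adj hmax hfe.symm hea hfa he
  have hbf : ¬ G.Adj b f := fun hbf => hfe (h.eq_of_adj hmax hab hfa.symm hbf hea.symm heb.symm)
  have hw : ∀ p ∈ (G.neighborFinset b).erase e, ∃ w, G.Adj f w ∧ G.Adj p w := by
    intro p hp
    obtain ⟨hpe, hbp⟩ : p ≠ e ∧ G.Adj b p := Finset.mem_erase.1 hp |>.imp id (by simp)
    have hfp : f ≠ p := fun hfp => hbf (hfp ▸ hbp)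
    apply exists_adj_of_codegree
    have h1 := h.three_mul_lt hfe.symm hpe.symm hfp
    have h2 := one_le_codegree hea hfa
    have h3 := one_le_codegree heb hbp.symm
    have h4 := hmax p
    omega
  choose! w hfw hpw using hw
  have hmaps : Set.MapsTo w ((G.neighborFinset b).erase e) ((G.neighborFinset f).erase a) := by
    intro p hp
    obtain ⟨hpe, hbp⟩ : p ≠ e ∧ G.Adj b p := Finset.mem_erase.1 hp |>.imp id (by simp)
    have hwa : w p ≠ a := fun hwa =>
      hpe (h.eq_of_adj hmax hab (hwa ▸ (hpw p hp).symm) hbp hea.symm heb.symm)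
    simpa using ⟨hfw p hp, hwa⟩
  have hinj : Set.InjOn w ((G.neighborFinset b).erase e) := by
    intro p hp p' hp' hpp
    have hbp : G.Adj b p := (Finset.mem_erase.1 hp |>.imp id (by simp) : p ≠ e ∧ G.Adj b p).2
    have hbp' : G.Adj b p' := (Finset.mem_erase.1 hp' |>.imp id (by simp) : p' ≠ e ∧ G.Adj b p').2
    have hne : b ≠ w p := fun hbw => hbf (hbw ▸ (hfw p hp).symm)
    exact h.eq_of_adj hmax hne hbp (hpw p hp).symm hbp' (hpp ▸ (hpw p' hp').symm)
  have hcard : ((G.neighborFinset f).erase a).card ≤ ((G.neighborFinset b).erase e).card := by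
    rw [Finset.card_erase_of_mem (by simpa using hfa),
      Finset.card_erase_of_mem (by simpa using heb.symm)]
    simp [hf, hb]
  obtain ⟨p, hp, rfl⟩ := Finset.surjOn_of_injOn_of_card_le w hmaps hinj hcard
    (show l ∈ ((G.neighborFinset f).erase a : Set V) by simpa using ⟨hfl, hla⟩)
  have hp' : p ≠ e ∧ G.Adj b p := Finset.mem_erase.1 hp |>.imp id (by simp)
  exact ⟨p, hp'.1, hp'.2, (hpw p hp).symm⟩

lemma exists_adj_ne (h : G.SqAdjExceeds D) (hD : 1 ≤ D) (v w : V) : ∃ a, G.Adj v a ∧ a ≠ w := by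
  obtain ⟨a, ha, haw⟩ := Finset.exists_mem_ne (s := G.neighborFinset v)
    (by have := h.degree_gt v; simp; omega) w
  exact ⟨a, by simpa using ha, haw⟩

lemma exists_adj_degree_eq (h : G.SqAdjExceeds D) (hmax : ∀ v, G.degree v ≤ D + 2) {s : Finset V}
    {v : V} (hs : s ⊆ G.neighborFinset v) (hcard : 1 < s.card) :
    ∃ b ∈ s, G.degree b = D + 2 := by
  obtain ⟨a, ha, b, hb, hab⟩ := Finset.one_lt_card.1 hcard
  by_cases had : G.degree a = D + 2
  · exact ⟨a, ha, had⟩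
  · have hva : G.Adj v a := by simpa using hs ha
    have hvb : G.Adj v b := by simpa using hs hb
    have := hmax a
    exact ⟨b, hb, h.degree_eq_of_adj hmax hab hva.symm hvb.symm (by omega)⟩

/-- If all eigenvalues of the adjacency matrix have square larger than `D ≥ 1` and all degrees are
at most `D + 2`, then the graph is regular. -/
theorem degree_eq (h : G.SqAdjExceeds D) (hD : 1 ≤ D) (hmax : ∀ v, G.degree v ≤ D + 2) (e : V) :
    G.degree e = D + 2 := by
  by_contra hne
  have he : G.degree e ≤ D + 1 := by have := hmax e; omega
  have hdeg := h.degree_gt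
  obtain ⟨b, hb, hbd⟩ := h.exists_adj_degree_eq hmax (Finset.Subset.refl (G.neighborFinset e))
    (by have := hdeg e; simp; omega)
  have heb : G.Adj e b := by simpa using hb
  obtain ⟨a, hea, hab⟩ := h.exists_adj_ne hD e b
  obtain ⟨f, haf, hfe⟩ := h.exists_adj_ne hD a e
  have hf : G.degree f = D + 2 := h.degree_eq_of_adj hmax hfe.symm hea haf.symm he
  obtain ⟨l, hl, hld⟩ := h.exists_adj_degree_eq hmax
    (Finset.erase_subset a (G.neighborFinset f))
    (by rw [Finset.card_erase_of_mem (by simpa using haf.symm)]; simp; omega)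
  obtain ⟨hla, hfl⟩ : l ≠ a ∧ G.Adj f l := by simpa using hl
  have hel : ¬ G.Adj e l := fun hel => hla (h.eq_of_adj hmax hfe hfl hel haf.symm hea)
  obtain ⟨p, hpe, hbp, hlp⟩ := h.exists_common_adj hmax he hab hea heb hbd hfe haf.symm hfl hla
  obtain ⟨x, hlx, hxe⟩ := h.exists_adj_codegree_eq_zero hmax he hld hel
  have hfp : f ≠ p := by
    rintro rfl
    exact hfe (h.eq_of_adj hmax hab haf hbp hea.symm heb.symm)
  have h1 := one_le_codegree hea haf.symm
  have h2 := one_le_codegree heb hbp.symm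
  have h3 := one_le_codegree hlx.symm hfl
  have h4 := one_le_codegree hlx.symm hlp.symm
  have hxe' : x ≠ e := by
    rintro rfl
    exact hel hlx.symm
  have hxf : x ≠ f := by
    rintro rfl
    rw [codegree_comm] at hxe
    omega
  have hxp : x ≠ p := by
    rintro rfl
    rw [codegree_comm] at hxe
    omega
  have h5 := h.four_mul_lt hfe.symm hpe.symm hfp hxe' hxf hxp
  have h6 := h.codegree_le_one hmax hfp
  have h7 := hmax x
  have h8 := hmax p
  omega

end SqAdjExceeds

/-- If the median eigenvalues of a bipartite graph exceed `c` in absolute value, then so do all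
the others. -/
lemma IsBipartite.lt_abs_eigenvalues₀_of_lt_hlIndex [Nonempty V] (h : G.IsBipartite) {c : ℝ}
    (hc : c < G.hlIndex) (k : Fin (Fintype.card V)) :
    c < |(G.isHermitian_adjMatrix ℝ).eigenvalues₀ k| := by
  have hrev := (G.isHermitian_adjMatrix ℝ).eigenvalues₀_rev h.charpoly_neg_adjMatrix
  have hpos := Fintype.card_pos (α := V)
  unfold hlIndex nthEigenvalue at hc
  set i : Fin (Fintype.card V) := ⟨(Fintype.card V + 1) / 2 - 1, by omega⟩ with hi
  set j : Fin (Fintype.card V) := ⟨(Fintype.card V + 2) / 2 - 1, by omega⟩ with hj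
  have hji : i.rev = j := by
    ext
    simp only [Fin.val_rev, hi, hj]
    omega
  rw [← hji, hrev, abs_neg, max_self] at hc
  refine (G.isHermitian_adjMatrix ℝ).eigenvalues₀_antitone.lt_abs_of_rev hrev ?_ hji ?_ hc k
  · simp only [hi, hj]
    omega
  · rw [Fin.le_def]
    simp only [hi, hj]
    omega

lemma IsBipartite.sqAdjExceeds_of_lt_hlIndex [Nonempty V] (h : G.IsBipartite) {d : ℝ}
    (hd : Real.sqrt d < G.hlIndex) : G.SqAdjExceeds d := by
  intro z hz
  refine (Matrix.IsHermitian.posDef_mul_self_sub (G.isHermitian_adjMatrix ℝ)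
    fun i => ?_).dotProduct_mulVec_pos hz
  rw [← sq_abs]
  exact Real.lt_sq_of_sqrt_lt (h.lt_abs_eigenvalues₀_of_lt_hlIndex hd _)

end SimpleGraph

theorem theorem2p3 {V : Type*} [Fintype V] [DecidableEq V] [Nonempty V]
    (G : SimpleGraph V) [DecidableRel G.Adj]
    (hconn : G.Connected) (hbip : G.IsBipartite)
    (hnonreg : ¬ ∃ k : ℕ, G.IsRegularOfDegree k)
    (hΔ : 3 ≤ G.maxDegree) :
    G.hlIndex ≤ Real.sqrt ((G.maxDegree : ℝ) - 2) := by
  by_contra! hlt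
  obtain ⟨D, hD⟩ : ∃ D, G.maxDegree = D + 2 := ⟨G.maxDegree - 2, by omega⟩
  have hcast : (G.maxDegree : ℝ) - 2 = D := by rw [hD]; push_cast; ring
  rw [hcast] at hlt
  refine hnonreg ⟨D + 2, (hbip.sqAdjExceeds_of_lt_hlIndex hlt).degree_eq (by omega) fun v => ?_⟩
  exact hD ▸ G.degree_le_maxDegree v
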